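/- Let $1<q<p$ be real numbers. Let $\mathcal R$ be the Riemann surface of the logarithm, and let $[n]_{p,q}^!=\prod_{j=1}^n\frac{p^j-q^j}{p-q}$, $m_{p,q}=([n]^!_{p,q})_{n\ge 0}$. For $a>1$ put $$[n]_a^!=\prod_{j=1}^n\frac{a^j-1}{a-1},\qquad \exp_a(z)=\sum_{n\ge0}\frac{z^n}{[n]_a^!},\qquad \Theta_q(z)=\sum_{n\in\mathbb Z}\frac{z^n}{q^{n(n-1)/2}},$$ $$\tilde e_1(z)=\frac{p/q-1}{\log p-\log q}\,\frac{z}{\exp_{p/q}(pz/q)},\qquad \tilde e_2(z)=\frac{q}{\log q}\,\frac{z}{\Theta_q(qz)} .$$ For a sequence $M=(M_n)_{n\ge0}$ of positive reals let $\omega_M(t)=\sup_{n\ge0}\log(t^n/M_n)$ for $t>0$ and $\omega_M(0)=0$. For an unbounded sector $S\subset\mathcal R$ with vertex at the origin and $k>0$, let $\mathcal O^{M,k}(S)$ be the set of holomorphic functions $f$ on $S$, continuous at the origin, such that for every proper unbounded subsector $T$ of $S$ there is $c>0$ with $|f(z)|\le c\,e^{\omega_M(|z|/k)}$ for all $z\in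 T$. **Proposition.** Let $f\in\mathcal O^{m_{p,q},k}(S)$ for some unbounded sector $S\subset\mathcal R$ and some $k>1$, and let $z\in\mathcal R$ with $|z|<\min\{p/q-1,\,k\}$. Then there exist a neighborhood $U\subset\mathcal R$ of $z$ and real numbers $\theta,\phi$, with the ray of direction $\theta$ contained in $S$, such that for every $z'\in U$ the double integral $$\int_0^{\infty(\theta+\phi)}\int_0^{\infty(\theta)}\tilde e_1(v/z')\,\tilde e_2(u/v)\,f(u)\,\frac{du}{u}\,\frac{dv}{v}$$ converges absolutely, i.e. $$\int_0^\infty\!\!\int_0^\infty\bigl|\tilde e_1(v/z')\,\tilde e_2(u/v)\,f(u)\bigr|\,\frac{dr}{r}\,\frac{ds}{s}<\infty,\qquad u=re^{i\theta},\ v=se^{i(\theta+\phi)} .$$ -/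

import Mathlib

open Set Filter Topology MeasureTheory
open scoped ENNReal

noncomputable section

/-- The Riemann surface of the logarithm, in polar coordinates: pairs `(r, t)` of a modulus
`r > 0` and an argument `t : ℝ` (arguments are not taken modulo `2π`). -/
abbrev LogSurface : Type := {x : ℝ × ℝ // 0 < x.1}

namespace LogSurface

/-- The modulus `|z|`. -/
def modulus (z : LogSurface) : ℝ := z.1.1

/-- The argument of `z`. -/
def arg (z : LogSurface) : ℝ := z.1.2

/-- The covering projection onto `ℂ \ {0}`. -/
def toComplex (z : LogSurface) : ℂ := (z.modulus : ℂ) * Complex.exp ((z.arg : ℂ) * Complex.I)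

/-- The global holomorphic chart: the point `e ^ w` of the surface, with modulus `e ^ (re w)` and
argument `im w`. -/
def ofLog (w : ℂ) : LogSurface := ⟨(Real.exp w.re, w.im), Real.exp_pos _⟩

open Classical in
/-- The point of modulus `r` on the ray of argument `t`, for `r > 0`
(for `r ≤ 0`, where it is never used, an arbitrary point). -/
def ray (t r : ℝ) : LogSurface :=
  if h : 0 < r then ⟨(r, t), h⟩ else ⟨(1, t), one_pos⟩

/-- The unbounded open sector with vertex at the origin, bisecting direction `d` and
opening `α`. -/
def sector (d α : ℝ) : Set LogSurface := {z | |z.arg - d| < α / 2}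

/-- `f` is holomorphic on the subset `S` of the surface. -/
def HolomorphicOn (f : LogSurface → ℂ) (S : Set LogSurface) : Prop :=
  DifferentiableOn ℂ (fun w => f (ofLog w)) (ofLog ⁻¹' S)

end LogSurface

/-- The `(p,q)`-factorial `∏_{j=1}^n (p^j - q^j) / (p - q)`. -/
def pqFactorial (p q : ℝ) (n : ℕ) : ℝ :=
  ∏ j ∈ Finset.Icc 1 n, (p ^ j - q ^ j) / (p - q)

/-- The `q`-factorial `∏_{j=1}^n (q^j - 1) / (q - 1)`. -/
def qFactorial (q : ℝ) (n : ℕ) : ℝ :=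
  ∏ j ∈ Finset.Icc 1 n, (q ^ j - 1) / (q - 1)

/-- The `q`-exponential function `∑_{n ≥ 0} z^n / [n]_q!`. -/
def qExp (q : ℝ) (z : ℂ) : ℂ := ∑' n : ℕ, z ^ n / (qFactorial q n : ℂ)

/-- The Jacobi Theta function `∑_{n ∈ ℤ} z^n / q^(n(n-1)/2)`; the integer division is exact. -/
def jacobiThetaQ (q : ℝ) (z : ℂ) : ℂ :=
  ∑' n : ℤ, z ^ n / (q : ℂ) ^ (n * (n - 1) / 2)

/-- The kernel `e₁`, whose moments are the `p/q`-factorials. -/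
def kernelOne (p q : ℝ) (z : ℂ) : ℂ :=
  (((p / q - 1) / (Real.log p - Real.log q) : ℝ) : ℂ) * (1 / qExp (p / q) ((p : ℂ) * z / (q : ℂ)))

/-- The kernel `e₂`, whose moments are `q^(n(n-1)/2)`. -/
def kernelTwo (q : ℝ) (z : ℂ) : ℂ :=
  ((q / Real.log q : ℝ) : ℂ) * (1 / jacobiThetaQ q ((q : ℂ) * z))

/-- `ẽ₁(z) = z e₁(z)`. -/
def kernelOneTilde (p q : ℝ) (z : ℂ) : ℂ := z * kernelOne p q z

/-- `ẽ₂(z) = z e₂(z)`. -/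
def kernelTwoTilde (q : ℝ) (z : ℂ) : ℂ := z * kernelTwo q z

open Classical in
/-- The function `ω_M(t) = sup_{n ≥ 0} log (t^n / M_n)` for `t > 0`, and `ω_M(0) = 0`. -/
def weightOmega (M : ℕ → ℝ) (t : ℝ) : ℝ :=
  if t = 0 then 0 else ⨆ n : ℕ, Real.log (t ^ n / M n)

/-- The class `O^{M,k}(S)` for the unbounded sector `S` of bisecting direction `d` and opening `α`:
functions holomorphic on `S`, continuous at the origin (they have a finite limit as `z → 0` in `S`),
with `|f(z)| ≤ c exp (ω_M(|z| / k))` on every proper unbounded subsector `T` of `S`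
(that is, a sector whose closure in the surface is contained in `S`), where `c` may depend
on `T`. -/
structure MemGrowthClass (M : ℕ → ℝ) (k d α : ℝ) (f : LogSurface → ℂ) : Prop where
  holomorphic : LogSurface.HolomorphicOn f (LogSurface.sector d α)
  continuous_zero : ∃ l : ℂ,
    Tendsto f (comap LogSurface.modulus (𝓝 0) ⊓ 𝓟 (LogSurface.sector d α)) (𝓝 l)
  growth : ∀ d' β : ℝ, 0 < β →
    closure (LogSurface.sector d' β) ⊆ LogSurface.sector d α →
    ∃ c : ℝ, 0 < c ∧ ∀ z ∈ LogSurface.sector d' β,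
      ‖f z‖ ≤ c * Real.exp (weightOmega M (z.modulus / k))

/-- The integrand `ẽ₁(v/z) ẽ₂(u/v) f(u) (1/r) (1/s)` with `u` of modulus `r` and argument `θ`, and
`v` of modulus `s` and argument `θ + φ`; along these rays `du/u = dr/r` and `dv/v = ds/s`. -/
def convIntegrand (p q : ℝ) (f : LogSurface → ℂ) (z : LogSurface) (θ φ : ℝ)
    (s r : ℝ) : ℂ :=
  let u := LogSurface.ray θ r
  let v := LogSurface.ray (θ + φ) s
  kernelOneTilde p q (v.toComplex / z.toComplex) * kernelTwoTilde q (u.toComplex / v.toComplex)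
    * f u * ((1 / r : ℝ) : ℂ) * ((1 / s : ℝ) : ℂ)

end

/-!
The directions of `u` and `v` are taken equal (`φ = 0`), so that `u / v = r / s > 0`, where `Θ_q`
is a series of positive terms. The common direction `θ` is chosen so that `e^{iθ} / z` avoids the
negative real axis, which carries all the zeros of `exp_{p/q}`; this condition, like `|z| < k`, is
open in `z`.

With `e^{ω_M(t)} ≤ ∑ tⁿ / Mₙ`, the inner integral is controlled by the moments of `|e₂|`. The
functional equation `Θ_q(q z) = q z Θ_q(z)` makes the `n`-th one `q^{n(n-1)/2}` times the `0`-th,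
and `[n]_{p,q}! = q^{n(n-1)/2} [n]_{p/q}!`, so the inner integral is at most a constant times
`|e₁(v / z)| exp_{p/q}(|v| / k)`.

By the functional equation `exp_a(a z) = (1 + (a - 1) z) exp_a(z)` with `a = p / q`, replacing `v`
by `a v` multiplies this bound by a factor tending to `|z| / (a k)`. Together with the Jacobian `a`
this gives the ratio `|z| / k < 1`, so the integrals over the shells `aⁿ T ≤ |v| < aⁿ⁺¹ T` decay
geometrically.
-/

variable {a p q k : ℝ}

lemma lintegral_image_mul_left (ha : 0 < a) {s : Set ℝ} (hs : MeasurableSet s)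
    (g : ℝ → ℝ≥0∞) :
    ∫⁻ x in (a * ·) '' s, g x = ENNReal.ofReal a * ∫⁻ x in s, g (a * x) := by
  rw [lintegral_image_eq_lintegral_abs_deriv_mul hs
    (fun x _ => by simpa using ((hasDerivAt_id x).const_mul a).hasDerivWithinAt)
    (mul_right_injective₀ ha.ne').injOn g, abs_of_pos ha,
    lintegral_const_mul' _ _ ENNReal.ofReal_ne_top]

lemma lintegral_Ioi_comp_mul_left (ha : 0 < a) (g : ℝ → ℝ≥0∞) :
    ∫⁻ x in Ioi (0 : ℝ), g x = ENNReal.ofReal a * ∫⁻ x in Ioi (0 : ℝ), g (a * x) := by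
  simpa [image_mul_left_Ioi ha] using
    lintegral_image_mul_left ha (measurableSet_Ioi (a := (0 : ℝ))) g

lemma lintegral_Ici_lt_top_of_dilation_le {h : ℝ → ℝ≥0∞} {T : ℝ} {ρ : ℝ≥0∞} (ha : 1 < a)
    (hT : 0 < T) (hρ : ρ < 1) (hle : ∀ s, T ≤ s → ENNReal.ofReal a * h (a * s) ≤ ρ * h s)
    (hfin : ∫⁻ s in Ico T (a * T), h s < ⊤) : ∫⁻ s in Ici T, h s < ⊤ := by
  have ha0 : 0 < a := by linarith
  let J : ℕ → Set ℝ := fun n => Ico (a ^ n * T) (a ^ (n + 1) * T)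
  have hcover : Ici T ⊆ ⋃ n, J n := fun s hs => by
    obtain ⟨n, hn, hn'⟩ := exists_nat_pow_near ((one_le_div hT).mpr hs) ha
    exact mem_iUnion.mpr ⟨n, (le_div_iff₀ hT).mp hn, (div_lt_iff₀ hT).mp hn'⟩
  have hgeom : ∀ n, ∫⁻ s in J n, h s ≤ ρ ^ n * ∫⁻ s in J 0, h s := by
    intro n
    induction n with
    | zero => simp
    | succ n ih =>
      have himage : J (n + 1) = (a * ·) '' J n := by
        simp only [J, image_mul_left_Ico ha0, ← mul_assoc, ← pow_succ']
      calc ∫⁻ s in J (n + 1), h s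
          = ∫⁻ s in J n, ENNReal.ofReal a * h (a * s) := by
            rw [himage, lintegral_image_mul_left ha0 measurableSet_Ico,
              lintegral_const_mul' _ _ ENNReal.ofReal_ne_top]
        _ ≤ ∫⁻ s in J n, ρ * h s := setLIntegral_mono' measurableSet_Ico fun s hs =>
            hle s ((le_mul_of_one_le_left hT.le (one_le_pow₀ ha.le)).trans hs.1)
        _ = ρ * ∫⁻ s in J n, h s := lintegral_const_mul' _ _ hρ.ne_top
        _ ≤ ρ ^ (n + 1) * ∫⁻ s in J 0, h s := by
            rw [pow_succ', mul_assoc]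
            gcongr
  calc ∫⁻ s in Ici T, h s
      ≤ ∑' n, ∫⁻ s in J n, h s := (lintegral_mono_set hcover).trans (lintegral_iUnion_le _ _)
    _ ≤ ∑' n, ρ ^ n * ∫⁻ s in J 0, h s := ENNReal.tsum_le_tsum hgeom
    _ < ⊤ := by
        rw [ENNReal.tsum_mul_right]
        exact ENNReal.mul_lt_top (tsum_geometric_lt_top.mpr hρ) (by simpa [J] using hfin)

lemma lintegral_enorm_Ioi_lt_top_of_tendsto_dilation {h m : ℝ → ℂ} (ha : 1 < a)
    (hcont : ContinuousOn h (Ici 0)) (hdil : ∀ s, h (a * s) = m s * h s) {L : ℝ} (hL : L < 1)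
    (hm : Tendsto (fun s => ‖(a : ℂ) * m s‖) atTop (𝓝 L)) :
    ∫⁻ s in Ioi 0, ‖h s‖ₑ < ⊤ := by
  have ha0 : 0 < a := zero_lt_one.trans ha
  have hfin : ∀ T, ∫⁻ s in Icc 0 T, ‖h s‖ₑ < ⊤ := fun T =>
    (hcont.mono Icc_subset_Ici_self).integrableOn_Icc.hasFiniteIntegral
  obtain ⟨ρ, hLρ, hρ⟩ := exists_between hL
  obtain ⟨T, hT, hT0⟩ := ((eventually_forall_ge_atTop.mpr (hm.eventually_le_const hLρ)).and
    (eventually_gt_atTop 0)).exists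
  have hcontract : ∀ s, T ≤ s → ENNReal.ofReal a * ‖h (a * s)‖ₑ ≤ ENNReal.ofReal ρ * ‖h s‖ₑ := by
    intro s hs
    have hjac : ENNReal.ofReal a = ‖(a : ℂ)‖ₑ := by
      rw [← ofReal_norm, Complex.norm_real, Real.norm_of_nonneg ha0.le]
    rw [hdil, hjac, enorm_mul, ← mul_assoc, ← enorm_mul, ← ofReal_norm (_ * m s)]
    gcongr
    exact hT s hs
  have htail : ∫⁻ s in Ici T, ‖h s‖ₑ < ⊤ :=
    lintegral_Ici_lt_top_of_dilation_le ha hT0 (ENNReal.ofReal_lt_one.mpr hρ) hcontract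
      ((lintegral_mono_set (Ico_subset_Icc_self.trans (Icc_subset_Icc_left hT0.le))).trans_lt
        (hfin (a * T)))
  calc ∫⁻ s in Ioi 0, ‖h s‖ₑ
      ≤ ∫⁻ s in Icc 0 T ∪ Ici T, ‖h s‖ₑ :=
        lintegral_mono_set (Icc_union_Ici_eq_Ici hT0.le ▸ Ioi_subset_Ici_self)
    _ ≤ _ := lintegral_union_le _ _ _
    _ < ⊤ := ENNReal.add_lt_top.mpr ⟨hfin T, htail⟩

lemma tendsto_one_add_mul_div_one_add_mul_atTop (b : ℂ) {c : ℂ} (hc : c ≠ 0) :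
    Tendsto (fun s : ℝ => (1 + s * b) / (1 + s * c)) atTop (𝓝 (b / c)) := by
  have hinv : Tendsto (fun s : ℝ => (s : ℂ)⁻¹) atTop (𝓝 0) := by
    simpa [Function.comp_def] using
      (Complex.continuous_ofReal.tendsto 0).comp tendsto_inv_atTop_zero
  have hlim : Tendsto (fun s : ℝ => ((s : ℂ)⁻¹ + b) / ((s : ℂ)⁻¹ + c)) atTop (𝓝 (b / c)) := by
    simpa [Pi.div_def] using (hinv.add_const b).div (hinv.add_const c) (by simpa using hc)
  refine hlim.congr' ?_
  filter_upwards [eventually_gt_atTop 0] with s hs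
  have hs' : (s : ℂ) ≠ 0 := by exact_mod_cast hs.ne'
  rw [← mul_div_mul_left _ _ hs', mul_add, mul_add, mul_inv_cancel₀ hs']

lemma ofReal_mul_mem_slitPlane {c : ℝ} (hc : 0 < c) {z : ℂ} (hz : z ∈ Complex.slitPlane) :
    c * z ∈ Complex.slitPlane := by
  simpa [Complex.mem_slitPlane_iff, hc, hc.ne'] using hz

lemma one_add_ne_zero_of_mem_slitPlane {z : ℂ} (hz : z ∈ Complex.slitPlane) : 1 + z ≠ 0 := by
  intro h
  rw [eq_neg_of_add_eq_zero_right h, ← Complex.ofReal_one, Complex.neg_ofReal_mem_slitPlane] at hz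
  linarith

lemma qFactorial_succ (a : ℝ) (n : ℕ) :
    qFactorial a (n + 1) = qFactorial a n * ((a ^ (n + 1) - 1) / (a - 1)) := by
  rw [qFactorial, Finset.prod_Icc_succ_top (by omega), qFactorial]

lemma qFactorial_pos (ha : 1 < a) (n : ℕ) : 0 < qFactorial a n := by
  refine Finset.prod_pos fun j hj => div_pos (sub_pos.mpr (one_lt_pow₀ ha ?_)) (sub_pos.mpr ha)
  exact Nat.one_le_iff_ne_zero.mp (Finset.mem_Icc.mp hj).1

lemma pqFactorial_eq_pow_mul_qFactorial (p : ℝ) (hq : q ≠ 0) (n : ℕ) :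
    pqFactorial p q n = q ^ n.choose 2 * qFactorial (p / q) n := by
  induction n with
  | zero => simp [pqFactorial, qFactorial]
  | succ n ih =>
    have hfactor : (p ^ (n + 1) - q ^ (n + 1)) / (p - q)
        = q ^ n * (((p / q) ^ (n + 1) - 1) / (p / q - 1)) := by
      rw [div_pow, div_sub_one hq, div_sub_one (pow_ne_zero _ hq)]
      field_simp
      ring
    rw [pqFactorial, Finset.prod_Icc_succ_top (by omega), ← pqFactorial, ih, hfactor,
      qFactorial_succ, Nat.choose_succ_succ', Nat.choose_one_right]
    ring

lemma pqFactorial_pos (hq : 0 < q) (hpq : q < p) (n : ℕ) : 0 < pqFactorial p q n := by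
  rw [pqFactorial_eq_pow_mul_qFactorial p hq.ne']
  exact mul_pos (pow_pos hq _) (qFactorial_pos ((one_lt_div hq).mpr hpq) n)

lemma summable_pow_div_qFactorial (ha : 1 < a) (z : ℂ) :
    Summable fun n : ℕ => z ^ n / (qFactorial a n : ℂ) := by
  rcases eq_or_ne z 0 with rfl | hz
  · exact summable_of_ne_finset_zero (s := {0}) fun n hn => by
      rw [zero_pow (by simpa using hn), zero_div]
  have hne : ∀ n, (qFactorial a n : ℂ) ≠ 0 := fun n => by exact_mod_cast (qFactorial_pos ha n).ne'
  refine summable_of_ratio_test_tendsto_lt_one zero_lt_one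
    (Eventually.of_forall fun n => div_ne_zero (pow_ne_zero n hz) (hne n)) ?_
  have hgrowth : Tendsto (fun n : ℕ => a ^ (n + 1) - 1) atTop atTop :=
    tendsto_atTop_add_const_right _ _
      ((tendsto_add_atTop_iff_nat 1).mpr (tendsto_pow_atTop_atTop_of_one_lt ha))
  refine (hgrowth.const_div_atTop (‖z‖ * (a - 1))).congr fun n => ?_
  have hnum : 0 < a ^ (n + 1) - 1 := sub_pos.mpr (one_lt_pow₀ ha n.succ_ne_zero)
  have hden : 0 < a - 1 := sub_pos.mpr ha
  have hF := qFactorial_pos ha n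
  simp only [norm_div, norm_pow, Complex.norm_real, Real.norm_of_nonneg (qFactorial_pos ha _).le]
  rw [qFactorial_succ]
  field_simp
  ring

lemma continuous_qExp (ha : 1 < a) : Continuous (qExp a) := by
  refine continuous_iff_continuousAt.mpr fun z => ?_
  have h : ContinuousOn (qExp a) (Metric.ball 0 (‖z‖ + 1)) := by
    refine continuousOn_tsum (fun n => by fun_prop)
      (summable_pow_div_qFactorial ha (‖z‖ + 1 : ℝ)).norm fun n w hw => ?_
    rw [norm_div, norm_div, norm_pow, norm_pow, Complex.norm_real (‖z‖ + 1),
      Real.norm_of_nonneg (by positivity)]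
    gcongr
    exact (mem_ball_zero_iff.mp hw).le
  exact h.continuousAt (Metric.isOpen_ball.mem_nhds (by simp))

lemma qExp_zero (a : ℝ) : qExp a 0 = 1 := by
  rw [qExp, tsum_eq_single 0 fun n hn => by rw [zero_pow hn, zero_div]]
  simp [qFactorial]

lemma qExp_mul_left (ha : 1 < a) (z : ℂ) :
    qExp a (a * z) = (1 + (a - 1) * z) * qExp a z := by
  have hsum := summable_pow_div_qFactorial ha
  have hstep : ∀ n : ℕ, (a * z) ^ (n + 1) / (qFactorial a (n + 1) : ℂ)
      = z ^ (n + 1) / (qFactorial a (n + 1) : ℂ)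
        + (a - 1) * z * (z ^ n / (qFactorial a n : ℂ)) := fun n => by
    have hF : (qFactorial a n : ℂ) ≠ 0 := by exact_mod_cast (qFactorial_pos ha n).ne'
    have hnum : (a : ℂ) ^ (n + 1) - 1 ≠ 0 := by
      exact_mod_cast (sub_pos.mpr (one_lt_pow₀ ha n.succ_ne_zero)).ne'
    have hden : (a : ℂ) - 1 ≠ 0 := by exact_mod_cast (sub_pos.mpr ha).ne'
    rw [qFactorial_succ]
    push_cast
    field_simp
    ring
  have hshift : ∀ w : ℂ,
      qExp a w = 1 + ∑' n : ℕ, w ^ (n + 1) / (qFactorial a (n + 1) : ℂ) := fun w => by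
    rw [qExp, (hsum w).tsum_eq_zero_add]
    simp [qFactorial]
  have htail := (summable_nat_add_iff 1).mpr (hsum z)
  rw [hshift (a * z), tsum_congr hstep, htail.tsum_add ((hsum z).mul_left _), tsum_mul_left,
    ← add_assoc, ← hshift, ← qExp]
  ring

lemma qExp_inv_mul_eq_zero (ha : 1 < a) {z : ℂ} (hz : z ∈ Complex.slitPlane)
    (hzero : qExp a z = 0) : qExp a ((a⁻¹ : ℝ) * z) = 0 := by
  have ha0 : 0 < a := by linarith
  have hac : (a : ℂ) ≠ 0 := by exact_mod_cast ha0.ne'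
  have hfactor := qExp_mul_left ha ((a⁻¹ : ℝ) * z)
  rw [Complex.ofReal_inv, mul_inv_cancel_left₀ hac, hzero, ← Complex.ofReal_inv] at hfactor
  refine (mul_eq_zero.mp hfactor.symm).resolve_left ?_
  exact_mod_cast one_add_ne_zero_of_mem_slitPlane
    (ofReal_mul_mem_slitPlane (sub_pos.mpr ha) (ofReal_mul_mem_slitPlane (inv_pos.mpr ha0) hz))

lemma qExp_ne_zero (ha : 1 < a) {z : ℂ} (hz : z ∈ Complex.slitPlane) : qExp a z ≠ 0 := by
  intro hzero
  have ha_inv : 0 < a⁻¹ := inv_pos.mpr (by linarith)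
  have hzeros : ∀ n : ℕ, qExp a ((a⁻¹ ^ n : ℝ) * z) = 0 := by
    intro n
    induction n with
    | zero => simpa using hzero
    | succ n ih =>
      rw [pow_succ', Complex.ofReal_mul, mul_assoc]
      exact qExp_inv_mul_eq_zero ha (ofReal_mul_mem_slitPlane (pow_pos ha_inv n) hz) ih
  have hlim : Tendsto (fun n : ℕ => ((a⁻¹ ^ n : ℝ) : ℂ) * z) atTop (𝓝 0) := by
    have hpow := tendsto_pow_atTop_nhds_zero_of_lt_one ha_inv.le (inv_lt_one_of_one_lt₀ ha)
    simpa using ((Complex.continuous_ofReal.tendsto 0).comp hpow).mul_const z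
  have hone : Tendsto (fun n : ℕ => qExp a ((a⁻¹ ^ n : ℝ) * z)) atTop (𝓝 1) :=
    qExp_zero a ▸ ((continuous_qExp ha).tendsto 0).comp hlim
  simp only [hzeros] at hone
  exact zero_ne_one (tendsto_nhds_unique tendsto_const_nhds hone)

lemma enorm_qExp_ofReal (ha : 1 < a) {x : ℝ} (hx : 0 ≤ x) :
    ‖qExp a x‖ₑ = ∑' n : ℕ, ENNReal.ofReal (x ^ n / qFactorial a n) := by
  have hnonneg : ∀ n : ℕ, 0 ≤ x ^ n / qFactorial a n := fun n =>
    div_nonneg (pow_nonneg hx n) (qFactorial_pos ha n).le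
  have hsum : Summable fun n : ℕ => x ^ n / qFactorial a n := by
    exact_mod_cast summable_pow_div_qFactorial ha x
  have hreal : qExp a x = ((∑' n : ℕ, x ^ n / qFactorial a n : ℝ) : ℂ) := by
    rw [qExp]
    push_cast
    rfl
  rw [hreal, ← ofReal_norm, Complex.norm_real, Real.norm_of_nonneg (tsum_nonneg hnonneg),
    ENNReal.ofReal_tsum_of_nonneg hnonneg hsum]

lemma jacobiThetaQ_mul_left (hq : q ≠ 0) {z : ℂ} (hz : z ≠ 0) :
    jacobiThetaQ q (q * z) = q * z * jacobiThetaQ q z := by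
  have hqc : (q : ℂ) ≠ 0 := by exact_mod_cast hq
  rw [jacobiThetaQ, ← (Equiv.addRight (1 : ℤ)).tsum_eq, jacobiThetaQ, ← tsum_mul_left]
  refine tsum_congr fun n => ?_
  have hexponent : (n + 1) * (n + 1 - 1) / 2 = n * (n - 1) / 2 + n := by
    rw [← Int.add_mul_ediv_right _ _ two_ne_zero]
    ring_nf
  rw [Equiv.coe_addRight, hexponent, zpow_add₀ hqc, zpow_add_one₀ (mul_ne_zero hqc hz), mul_zpow]
  field_simp

lemma zpow_div_zpow_eq_norm_jacobiTheta₂_term (hq : 0 < q) {x : ℝ} (hx : 0 < x) (n : ℤ) :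
    x ^ n / q ^ (n * (n - 1) / 2)
      = ‖jacobiTheta₂_term n (-((Real.log x + Real.log q / 2) / (2 * Real.pi) : ℝ) * Complex.I)
          ((Real.log q / (2 * Real.pi) : ℝ) * Complex.I)‖ := by
  have hexact : ((n * (n - 1) / 2 : ℤ) : ℝ) = n * (n - 1) / 2 := by
    rw [Int.cast_div (Int.even_mul_pred_self n).two_dvd (by norm_num)]
    push_cast
    ring
  rw [norm_jacobiTheta₂_term, ← Real.rpow_intCast x, ← Real.rpow_intCast q, hexact,
    Real.rpow_def_of_pos hx, Real.rpow_def_of_pos hq, ← Real.exp_sub]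
  simp only [neg_mul, Complex.neg_im, Complex.im_ofReal_mul, Complex.I_im]
  congr 1
  field_simp
  ring

lemma summable_zpow_div_zpow (hq : 1 < q) {x : ℝ} (hx : 0 < x) :
    Summable fun n : ℤ => x ^ n / q ^ (n * (n - 1) / 2) := by
  simp only [zpow_div_zpow_eq_norm_jacobiTheta₂_term (zero_lt_one.trans hq) hx]
  refine ((summable_jacobiTheta₂_term_iff _ _).mpr ?_).norm
  have := Real.log_pos hq
  rw [Complex.im_ofReal_mul, Complex.I_im, mul_one]
  positivity

lemma one_add_sq_div_le_norm_jacobiThetaQ (hq : 1 < q) {x : ℝ} (hx : 0 < x) :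
    1 + x ^ 2 / q ≤ ‖jacobiThetaQ q x‖ := by
  have hreal : jacobiThetaQ q x = ((∑' n : ℤ, x ^ n / q ^ (n * (n - 1) / 2) : ℝ) : ℂ) := by
    rw [jacobiThetaQ]
    push_cast
    rfl
  have hterms := (summable_zpow_div_zpow hq hx).sum_le_tsum {0, 2} fun n _ => by positivity
  rw [Finset.sum_pair (by norm_num)] at hterms
  rw [hreal, Complex.norm_real]
  exact le_trans (by norm_num) (hterms.trans (le_abs_self _))

lemma measurable_kernelTwo (q : ℝ) : Measurable (kernelTwo q) := by
  unfold kernelTwo jacobiThetaQ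
  fun_prop

lemma kernelTwo_mul_left (hq : q ≠ 0) {z : ℂ} (hz : z ≠ 0) :
    kernelTwo q (q * z) = kernelTwo q z / (q ^ 2 * z) := by
  have hqc : (q : ℂ) ≠ 0 := by exact_mod_cast hq
  rw [kernelTwo, kernelTwo, jacobiThetaQ_mul_left hq (mul_ne_zero hqc hz)]
  field_simp

lemma norm_kernelTwo_ofReal_le (hq : 1 < q) {x : ℝ} (hx : 0 < x) :
    ‖kernelTwo q x‖ ≤ q / Real.log q * (1 + x ^ 2)⁻¹ := by
  have hlog := Real.log_pos hq
  have hΘ := one_add_sq_div_le_norm_jacobiThetaQ hq (x := q * x) (by positivity)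
  rw [kernelTwo, ← Complex.ofReal_mul, norm_mul, Complex.norm_real,
    Real.norm_of_nonneg (by positivity), one_div, norm_inv]
  gcongr
  calc 1 + x ^ 2 ≤ 1 + q * x ^ 2 := by nlinarith [sq_nonneg x]
    _ = 1 + (q * x) ^ 2 / q := by field_simp
    _ ≤ _ := hΘ

lemma lintegral_kernelTwo_lt_top (hq : 1 < q) : ∫⁻ x : ℝ in Ioi 0, ‖kernelTwo q x‖ₑ < ⊤ := by
  refine lt_of_le_of_lt (setLIntegral_mono' measurableSet_Ioi fun x (hx : 0 < x) => ?_)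
    ((integrable_inv_one_add_sq.const_mul (q / Real.log q)).integrableOn
      (s := Ioi (0 : ℝ))).lintegral_lt_top
  rw [← ofReal_norm]
  exact ENNReal.ofReal_le_ofReal (norm_kernelTwo_ofReal_le hq hx)

lemma lintegral_pow_mul_kernelTwo (hq : 0 < q) (n : ℕ) :
    ∫⁻ x : ℝ in Ioi 0, ‖x ^ n * kernelTwo q x‖ₑ
      = ENNReal.ofReal (q ^ n.choose 2) * ∫⁻ x : ℝ in Ioi 0, ‖kernelTwo q x‖ₑ := by
  induction n with
  | zero => simp
  | succ n ih =>
    have hqc : (q : ℂ) ≠ 0 := by exact_mod_cast hq.ne'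
    rw [Nat.choose_succ_succ', Nat.choose_one_right, pow_add, ENNReal.ofReal_mul (by positivity),
      mul_assoc, ← ih, lintegral_Ioi_comp_mul_left hq,
      ← lintegral_const_mul' _ _ ENNReal.ofReal_ne_top,
      ← lintegral_const_mul' _ _ ENNReal.ofReal_ne_top]
    refine setLIntegral_congr_fun measurableSet_Ioi fun x (hx : 0 < x) => ?_
    have hxc : (x : ℂ) ≠ 0 := by exact_mod_cast hx.ne'
    have hscale : q * (((q * x : ℝ) : ℂ) ^ (n + 1) * kernelTwo q (q * x : ℝ))
        = (q ^ n : ℝ) * (x ^ n * kernelTwo q x) := by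
      push_cast
      rw [kernelTwo_mul_left hq.ne' hxc]
      field_simp
      ring
    rw [← ofReal_norm, ← ofReal_norm, ← ENNReal.ofReal_mul hq.le,
      ← ENNReal.ofReal_mul (by positivity)]
    congr 1
    simpa [abs_of_pos hq] using congrArg norm hscale

lemma ofReal_exp_weightOmega_le_tsum {M : ℕ → ℝ} (hM : ∀ n, 0 < M n) {t : ℝ} (ht : 0 < t) :
    ENNReal.ofReal (Real.exp (weightOmega M t)) ≤ ∑' n, ENNReal.ofReal (t ^ n / M n) := by
  rcases eq_or_ne (∑' n, ENNReal.ofReal (t ^ n / M n)) ⊤ with htop | hfin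
  · exact htop ▸ le_top
  have hterm : ∀ n, t ^ n / M n ≤ (∑' n, ENNReal.ofReal (t ^ n / M n)).toReal := fun n =>
    (ENNReal.ofReal_le_iff_le_toReal hfin).mp (ENNReal.le_tsum n)
  have hpos : ∀ n, 0 < t ^ n / M n := fun n => div_pos (pow_pos ht n) (hM n)
  rw [ENNReal.ofReal_le_iff_le_toReal hfin,
    ← Real.le_log_iff_exp_le ((hpos 0).trans_le (hterm 0)), weightOmega, if_neg ht.ne']
  exact ciSup_le fun n => Real.log_le_log (hpos n) (hterm n)

lemma lintegral_mul_exp_weightOmega_le {M : ℕ → ℝ} (hM : ∀ n, 0 < M n) {g : ℝ → ℂ}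
    (hg : Measurable g) {t : ℝ} (ht : 0 < t) :
    ∫⁻ x in Ioi (0 : ℝ), ‖g x‖ₑ * ENNReal.ofReal (Real.exp (weightOmega M (t * x)))
      ≤ ∑' n, ENNReal.ofReal (t ^ n / M n) * ∫⁻ x : ℝ in Ioi 0, ‖x ^ n * g x‖ₑ := by
  calc ∫⁻ x in Ioi (0 : ℝ), ‖g x‖ₑ * ENNReal.ofReal (Real.exp (weightOmega M (t * x)))
      ≤ ∫⁻ x : ℝ in Ioi 0, ∑' n, ENNReal.ofReal (t ^ n / M n) * ‖x ^ n * g x‖ₑ := by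
        refine setLIntegral_mono' measurableSet_Ioi fun x (hx : 0 < x) => ?_
        grw [ofReal_exp_weightOmega_le_tsum hM (mul_pos ht hx), ← ENNReal.tsum_mul_left]
        refine (tsum_congr fun n => ?_).le
        have hM' := (hM n).le
        rw [enorm_mul, enorm_pow, ← ofReal_norm (x : ℂ), Complex.norm_real,
          Real.norm_of_nonneg hx.le, ← ENNReal.ofReal_pow hx.le, ← mul_assoc,
          ← ENNReal.ofReal_mul (by positivity), mul_comm, mul_pow, mul_div_right_comm]
    _ = ∑' n, ∫⁻ x : ℝ in Ioi 0, ENNReal.ofReal (t ^ n / M n) * ‖x ^ n * g x‖ₑ :=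
        lintegral_tsum fun n => by fun_prop
    _ = ∑' n, ENNReal.ofReal (t ^ n / M n) * ∫⁻ x : ℝ in Ioi 0, ‖x ^ n * g x‖ₑ :=
        tsum_congr fun n => lintegral_const_mul' _ _ ENNReal.ofReal_ne_top

lemma lintegral_kernelTwo_mul_exp_weightOmega_le (hq : 0 < q) (hpq : q < p) (hk : 0 < k) {s : ℝ}
    (hs : 0 < s) :
    ∫⁻ r : ℝ in Ioi 0, ‖kernelTwo q (r / s) / s‖ₑ *
        ENNReal.ofReal (Real.exp (weightOmega (pqFactorial p q) (r / k)))
      ≤ ‖qExp (p / q) (s / k)‖ₑ * ∫⁻ x : ℝ in Ioi 0, ‖kernelTwo q x‖ₑ := by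
  have hsk : 0 < s / k := div_pos hs hk
  calc _ = ∫⁻ x : ℝ in Ioi 0, ‖kernelTwo q x‖ₑ *
          ENNReal.ofReal (Real.exp (weightOmega (pqFactorial p q) (s / k * x))) := by
        rw [lintegral_Ioi_comp_mul_left hs, ← lintegral_const_mul' _ _ ENNReal.ofReal_ne_top]
        refine lintegral_congr fun x => ?_
        have hsc : (s : ℂ) ≠ 0 := by exact_mod_cast hs.ne'
        have hjac : ENNReal.ofReal s = ‖(s : ℂ)‖ₑ := by
          rw [← ofReal_norm, Complex.norm_real, Real.norm_of_nonneg hs.le]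
        rw [hjac, ← mul_assoc, ← enorm_mul, Complex.ofReal_mul, mul_div_cancel_left₀ _ hsc,
          mul_div_cancel₀ _ hsc, mul_div_right_comm]
    _ ≤ ∑' n, ENNReal.ofReal ((s / k) ^ n / pqFactorial p q n) *
          ∫⁻ x : ℝ in Ioi 0, ‖x ^ n * kernelTwo q x‖ₑ :=
        lintegral_mul_exp_weightOmega_le (pqFactorial_pos hq hpq)
          ((measurable_kernelTwo q).comp Complex.measurable_ofReal) hsk
    _ = ∑' n, ENNReal.ofReal ((s / k) ^ n / qFactorial (p / q) n) *
          ∫⁻ x : ℝ in Ioi 0, ‖kernelTwo q x‖ₑ := by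
        refine tsum_congr fun n => ?_
        have hpos := pqFactorial_pos hq hpq n
        rw [lintegral_pow_mul_kernelTwo hq, ← mul_assoc, ← ENNReal.ofReal_mul (by positivity),
          pqFactorial_eq_pow_mul_qFactorial p hq.ne', div_mul_eq_mul_div,
          mul_comm (q ^ _), mul_div_mul_right _ _ (by positivity)]
    _ = _ := by
        rw [ENNReal.tsum_mul_right, ← enorm_qExp_ofReal ((one_lt_div hq).mpr hpq) hsk.le,
          Complex.ofReal_div]

lemma kernelOne_mul_left (hpq : 1 < p / q) (z : ℂ) :
    kernelOne p q ((p / q : ℝ) * z)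
      = kernelOne p q z / (1 + (p / q - 1 : ℝ) * ((p / q : ℝ) * z)) := by
  have hdil : ∀ w : ℂ, (p : ℂ) * w / q = (p / q : ℝ) * w := fun w => by
    rw [Complex.ofReal_div, div_mul_eq_mul_div]
  rw [kernelOne, kernelOne, hdil, hdil, qExp_mul_left hpq, Complex.ofReal_sub, Complex.ofReal_one,
    mul_div_assoc, div_div, mul_comm (qExp _ _)]

lemma continuousOn_kernelOne_mul_qExp (hpq : 1 < p / q) {ζ : ℂ} (hζ : ζ ∈ Complex.slitPlane)
    (b : ℂ) :
    ContinuousOn (fun s : ℝ => kernelOne p q (s * ζ) * qExp (p / q) (s * b)) (Ici 0) := by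
  have hE := continuous_qExp hpq
  have hne : ∀ s ∈ Ici (0 : ℝ), qExp (p / q) (p * (s * ζ) / q) ≠ 0 := by
    intro s hs
    rcases (mem_Ici.mp hs).eq_or_lt with rfl | hs
    · simp [qExp_zero]
    · have := qExp_ne_zero hpq
        (ofReal_mul_mem_slitPlane (zero_lt_one.trans hpq) (ofReal_mul_mem_slitPlane hs hζ))
      rwa [Complex.ofReal_div, div_mul_eq_mul_div] at this
  unfold kernelOne
  fun_prop (disch := assumption)

lemma lintegral_kernelOne_mul_qExp_lt_top (hpq : 1 < p / q) {ζ b : ℂ}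
    (hζ : ζ ∈ Complex.slitPlane) (hb : ‖b‖ < ‖ζ‖) :
    ∫⁻ s : ℝ in Ioi 0, ‖kernelOne p q (s * ζ) * qExp (p / q) (s * b)‖ₑ < ⊤ := by
  have ha0 : ((p / q : ℝ) : ℂ) ≠ 0 := by exact_mod_cast (zero_lt_one.trans hpq).ne'
  have ha1 : ((p / q - 1 : ℝ) : ℂ) ≠ 0 := by exact_mod_cast (sub_pos.mpr hpq).ne'
  have hζ0 : ζ ≠ 0 := Complex.slitPlane_ne_zero hζ
  let m : ℝ → ℂ := fun s =>
    (1 + s * ((p / q - 1 : ℝ) * b)) / (1 + s * ((p / q - 1 : ℝ) * ((p / q : ℝ) * ζ)))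
  have hlim : Tendsto (fun s => ‖((p / q : ℝ) : ℂ) * m s‖) atTop (𝓝 (‖b‖ / ‖ζ‖)) := by
    have := ((tendsto_one_add_mul_div_one_add_mul_atTop ((p / q - 1 : ℝ) * b)
      (mul_ne_zero ha1 (mul_ne_zero ha0 hζ0))).const_mul ((p / q : ℝ) : ℂ)).norm
    rwa [mul_div_mul_left _ _ ha1, ← mul_div_assoc, mul_div_mul_left _ _ ha0, norm_div] at this
  refine lintegral_enorm_Ioi_lt_top_of_tendsto_dilation hpq
    (continuousOn_kernelOne_mul_qExp hpq hζ b) (m := m) (fun s => ?_)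
    ((div_lt_one (norm_pos_iff.mpr hζ0)).mpr hb) hlim
  have hshift : ∀ w : ℂ, ((p / q * s : ℝ) : ℂ) * w = (p / q : ℝ) * (s * w) := fun w => by
    rw [Complex.ofReal_mul, mul_assoc]
  rw [hshift, hshift, kernelOne_mul_left hpq, qExp_mul_left hpq]
  simp only [m]
  push_cast
  ring

namespace LogSurface

lemma continuous_modulus : Continuous modulus := continuous_fst.comp continuous_subtype_val

lemma continuous_arg : Continuous arg := continuous_snd.comp continuous_subtype_val

lemma continuous_toComplex : Continuous toComplex := by
  have := continuous_modulus
  have := continuous_arg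
  unfold toComplex
  fun_prop

lemma toComplex_ne_zero (z : LogSurface) : z.toComplex ≠ 0 :=
  mul_ne_zero (by exact_mod_cast z.2.ne') (Complex.exp_ne_zero _)

lemma norm_toComplex (z : LogSurface) : ‖z.toComplex‖ = z.modulus := by
  rw [toComplex, norm_mul, Complex.norm_exp_ofReal_mul_I, mul_one, Complex.norm_real,
    Real.norm_of_nonneg (show 0 < z.modulus from z.2).le]

/-- The inverse of the global chart `ofLog`. -/
noncomputable def log (z : LogSurface) : ℂ := ⟨Real.log z.modulus, z.arg⟩

lemma ofLog_log (z : LogSurface) : ofLog z.log = z :=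
  Subtype.ext (Prod.ext (Real.exp_log z.2) rfl)

lemma continuous_log : Continuous log := by
  have hre : Continuous fun z : LogSurface => Real.log z.modulus :=
    continuous_modulus.log fun z => z.2.ne'
  exact Complex.equivRealProdCLM.symm.continuous.comp (hre.prodMk continuous_arg)

lemma HolomorphicOn.continuousOn {f : LogSurface → ℂ} {S : Set LogSurface}
    (hf : HolomorphicOn f S) : ContinuousOn f S := by
  have h := DifferentiableOn.continuousOn hf |>.comp continuous_log.continuousOn
    (s := S) fun z hz => by simpa [ofLog_log] using hz
  simpa [Function.comp_def, ofLog_log] using h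

lemma ray_of_pos {t r : ℝ} (hr : 0 < r) : ray t r = ⟨(r, t), hr⟩ := dif_pos hr

lemma modulus_ray {t r : ℝ} (hr : 0 < r) : (ray t r).modulus = r := by
  rw [ray_of_pos hr, modulus]

lemma arg_ray (t r : ℝ) : (ray t r).arg = t := by
  unfold ray arg
  split_ifs <;> rfl

lemma toComplex_ray {t r : ℝ} (hr : 0 < r) :
    (ray t r).toComplex = r * Complex.exp (t * Complex.I) := by
  rw [toComplex, modulus_ray hr, arg_ray]

lemma ray_mem_sector_iff {t r d α : ℝ} : ray t r ∈ sector d α ↔ |t - d| < α / 2 := by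
  rw [sector, mem_ofPred_eq, arg_ray]

lemma continuousOn_ray (t : ℝ) : ContinuousOn (ray t) (Ioi 0) := by
  rw [continuousOn_iff_continuous_domRestrict]
  have hray : (Ioi 0).domRestrict (ray t) = fun r => ⟨(r.1, t), r.2⟩ :=
    funext fun r => ray_of_pos r.2
  rw [hray]
  fun_prop

lemma closure_sector_subset_sector {θ β d α : ℝ} (h : |θ - d| + β / 2 < α / 2) :
    closure (sector θ β) ⊆ sector d α := by
  have hclosed : IsClosed {z : LogSurface | |z.arg - θ| ≤ β / 2} :=
    isClosed_le (continuous_arg.sub continuous_const).abs continuous_const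
  have hsub : sector θ β ⊆ {z : LogSurface | |z.arg - θ| ≤ β / 2} :=
    fun z (hz : |z.arg - θ| < β / 2) => hz.le
  intro z hz
  have hz' : |z.arg - θ| ≤ β / 2 := closure_minimal hsub hclosed hz
  exact (abs_sub_le z.arg θ d).trans_lt (by linarith)

lemma exp_div_toComplex_mem_slitPlane {θ : ℝ} {z : LogSurface} (h : Real.sin (θ - z.arg) ≠ 0) :
    Complex.exp (θ * Complex.I) / z.toComplex ∈ Complex.slitPlane := by
  have hpolar : Complex.exp (θ * Complex.I) / z.toComplex
      = (z.modulus⁻¹ : ℝ) * Complex.exp ((θ - z.arg : ℝ) * Complex.I) := by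
    rw [toComplex, Complex.ofReal_sub, sub_mul, Complex.exp_sub, Complex.ofReal_inv,
      div_mul_eq_div_div_swap, div_eq_inv_mul]
  rw [hpolar]
  refine ofReal_mul_mem_slitPlane (inv_pos.mpr z.2) (Complex.mem_slitPlane_iff.mpr (Or.inr ?_))
  rwa [Complex.exp_ofReal_mul_I_im]

lemma exists_exp_div_toComplex_mem_slitPlane (d : ℝ) {α : ℝ} (hα : 0 < α) (z : LogSurface) :
    ∃ θ : ℝ, |θ - d| < α / 2 ∧ Complex.exp (θ * Complex.I) / z.toComplex ∈ Complex.slitPlane := by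
  have hcount : {θ : ℝ | Real.sin (θ - z.arg) = 0}.Countable := by
    refine (countable_range fun n : ℤ => n * Real.pi + z.arg).mono fun θ hθ => ?_
    obtain ⟨n, hn⟩ := Real.sin_eq_zero_iff.mp hθ
    exact ⟨n, by linarith⟩
  obtain ⟨θ, hsin, hθ⟩ := (hcount.dense_compl ℝ).exists_between
    (show d - α / 2 < d + α / 2 by linarith)
  exact ⟨θ, abs_sub_lt_iff.mpr ⟨by linarith [hθ.2], by linarith [hθ.1]⟩,
    exp_div_toComplex_mem_slitPlane hsin⟩

end LogSurface

lemma MemGrowthClass.exists_norm_ray_le {M : ℕ → ℝ} {d α θ : ℝ} {f : LogSurface → ℂ}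
    (hf : MemGrowthClass M k d α f) (hθ : |θ - d| < α / 2) :
    ∃ c : ℝ, ∀ r : ℝ, 0 < r →
      ‖f (LogSurface.ray θ r)‖ ≤ c * Real.exp (weightOmega M (r / k)) := by
  obtain ⟨c, -, hc⟩ := hf.growth θ (α / 2 - |θ - d|) (by linarith)
    (LogSurface.closure_sector_subset_sector (by linarith))
  refine ⟨c, fun r hr => ?_⟩
  have hmem : LogSurface.ray θ r ∈ LogSurface.sector θ (α / 2 - |θ - d|) := by
    rw [LogSurface.ray_mem_sector_iff, sub_self, abs_zero]
    linarith
  simpa only [LogSurface.modulus_ray hr] using hc _ hmem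

section Convolution

variable {f : LogSurface → ℂ} {z : LogSurface} {θ : ℝ}

lemma convIntegrand_zero_eq (p q : ℝ) (f : LogSurface → ℂ) (z : LogSurface) (θ : ℝ) {s r : ℝ}
    (hs : 0 < s) (hr : 0 < r) :
    convIntegrand p q f z θ 0 s r =
      Complex.exp (θ * Complex.I) / z.toComplex *
        kernelOne p q (s * (Complex.exp (θ * Complex.I) / z.toComplex)) *
        (kernelTwo q (r / s) / s) * f (LogSurface.ray θ r) := by
  have hsc : (s : ℂ) ≠ 0 := by exact_mod_cast hs.ne'
  have hrc : (r : ℂ) ≠ 0 := by exact_mod_cast hr.ne'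
  have hvz : (LogSurface.ray (θ + 0) s).toComplex / z.toComplex
      = s * (Complex.exp (θ * Complex.I) / z.toComplex) := by
    rw [LogSurface.toComplex_ray hs, add_zero, mul_div_assoc]
  have huv : (LogSurface.ray θ r).toComplex / (LogSurface.ray (θ + 0) s).toComplex = r / s := by
    rw [LogSurface.toComplex_ray hs, LogSurface.toComplex_ray hr, add_zero,
      mul_div_mul_right _ _ (Complex.exp_ne_zero _)]
  simp only [convIntegrand, kernelOneTilde, kernelTwoTilde, hvz, huv, Complex.ofReal_div,
    Complex.ofReal_one]
  field_simp

lemma lintegral_convIntegrand_zero_le (hq : 0 < q) (hpq : q < p) (hk : 0 < k) {c : ℝ}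
    (hf : ∀ r : ℝ, 0 < r → ‖f (LogSurface.ray θ r)‖
      ≤ c * Real.exp (weightOmega (pqFactorial p q) (r / k))) (z : LogSurface) {s : ℝ}
    (hs : 0 < s) :
    ∫⁻ r in Ioi (0 : ℝ), ‖convIntegrand p q f z θ 0 s r‖ₑ
      ≤ ‖Complex.exp (θ * Complex.I) / z.toComplex *
            kernelOne p q (s * (Complex.exp (θ * Complex.I) / z.toComplex))‖ₑ *
          ENNReal.ofReal c *
          (‖qExp (p / q) (s / k)‖ₑ * ∫⁻ x : ℝ in Ioi 0, ‖kernelTwo q x‖ₑ) := by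
  set A := Complex.exp (θ * Complex.I) / z.toComplex *
    kernelOne p q (s * (Complex.exp (θ * Complex.I) / z.toComplex)) with hA
  calc ∫⁻ r in Ioi (0 : ℝ), ‖convIntegrand p q f z θ 0 s r‖ₑ
      ≤ ∫⁻ r : ℝ in Ioi 0, ‖A‖ₑ * ENNReal.ofReal c * (‖kernelTwo q (r / s) / s‖ₑ *
          ENNReal.ofReal (Real.exp (weightOmega (pqFactorial p q) (r / k)))) := by
        refine setLIntegral_mono' measurableSet_Ioi fun r hr => ?_
        have hfr := ENNReal.ofReal_le_ofReal (hf r hr)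
        rw [ofReal_norm, ENNReal.ofReal_mul' (Real.exp_pos _).le] at hfr
        calc ‖convIntegrand p q f z θ 0 s r‖ₑ
            = ‖A‖ₑ * ‖kernelTwo q (r / s) / s‖ₑ * ‖f (LogSurface.ray θ r)‖ₑ := by
              rw [convIntegrand_zero_eq p q f z θ hs hr, ← hA, enorm_mul, enorm_mul]
          _ ≤ ‖A‖ₑ * ‖kernelTwo q (r / s) / s‖ₑ * (ENNReal.ofReal c *
                ENNReal.ofReal (Real.exp (weightOmega (pqFactorial p q) (r / k)))) := by
              gcongr
          _ = _ := by ring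
    _ = ‖A‖ₑ * ENNReal.ofReal c * ∫⁻ r : ℝ in Ioi 0, ‖kernelTwo q (r / s) / s‖ₑ *
          ENNReal.ofReal (Real.exp (weightOmega (pqFactorial p q) (r / k))) :=
        lintegral_const_mul' _ _ (ENNReal.mul_lt_top enorm_lt_top ENNReal.ofReal_lt_top).ne
    _ ≤ _ := by
        grw [lintegral_kernelTwo_mul_exp_weightOmega_le hq hpq hk hs]

lemma lintegral_convIntegrand_zero_lt_top (hq : 1 < q) (hpq : q < p) {c : ℝ}
    (hf : ∀ r : ℝ, 0 < r → ‖f (LogSurface.ray θ r)‖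
      ≤ c * Real.exp (weightOmega (pqFactorial p q) (r / k)))
    (hz : z.modulus < k)
    (hζ : Complex.exp (θ * Complex.I) / z.toComplex ∈ Complex.slitPlane) :
    (∫⁻ s in Ioi (0 : ℝ), ∫⁻ r in Ioi (0 : ℝ), ‖convIntegrand p q f z θ 0 s r‖ₑ) < ⊤ := by
  have hq0 : 0 < q := zero_lt_one.trans hq
  have hz0 : 0 < z.modulus := z.2
  have hk : 0 < k := hz0.trans hz
  have hnorm : ‖(k⁻¹ : ℂ)‖ < ‖Complex.exp (θ * Complex.I) / z.toComplex‖ := by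
    rw [norm_div, Complex.norm_exp_ofReal_mul_I, LogSurface.norm_toComplex, one_div, norm_inv,
      Complex.norm_real, Real.norm_of_nonneg hk.le]
    exact inv_strictAnti₀ hz0 hz
  have houter := lintegral_kernelOne_mul_qExp_lt_top ((one_lt_div hq0).mpr hpq) hζ hnorm
  set ζ := Complex.exp (θ * Complex.I) / z.toComplex with hζ_def
  set K : ℝ≥0∞ := ‖ζ‖ₑ * ENNReal.ofReal c * ∫⁻ x : ℝ in Ioi 0, ‖kernelTwo q x‖ₑ with hK_def
  have hK : K < ⊤ := ENNReal.mul_lt_top (ENNReal.mul_lt_top enorm_lt_top ENNReal.ofReal_lt_top)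
    (lintegral_kernelTwo_lt_top hq)
  calc _ ≤ ∫⁻ s : ℝ in Ioi 0, K * ‖kernelOne p q (s * ζ) * qExp (p / q) (s * (k⁻¹ : ℂ))‖ₑ := by
        refine setLIntegral_mono' measurableSet_Ioi fun s hs =>
          (lintegral_convIntegrand_zero_le hq0 hpq hk hf z hs).trans_eq ?_
        rw [← hζ_def, hK_def, enorm_mul, enorm_mul, ← div_eq_mul_inv]
        ring
    _ = K * ∫⁻ s : ℝ in Ioi 0, ‖kernelOne p q (s * ζ) * qExp (p / q) (s * (k⁻¹ : ℂ))‖ₑ :=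
        lintegral_const_mul' _ _ hK.ne
    _ < ⊤ := ENNReal.mul_lt_top hK houter

lemma aestronglyMeasurable_convIntegrand_zero (hpq : 1 < p / q)
    (hf : AEStronglyMeasurable (fun r => f (LogSurface.ray θ r)) (volume.restrict (Ioi 0)))
    (z : LogSurface) :
    AEStronglyMeasurable (fun x : ℝ × ℝ => convIntegrand p q f z θ 0 x.1 x.2)
      (volume.restrict (Ioi (0 : ℝ) ×ˢ Ioi (0 : ℝ))) := by
  have hE := (continuous_qExp hpq).measurable
  have hΘ := measurable_kernelTwo q
  have hker : Measurable fun x : ℝ × ℝ => Complex.exp (θ * Complex.I) / z.toComplex *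
      kernelOne p q (x.1 * (Complex.exp (θ * Complex.I) / z.toComplex)) *
      (kernelTwo q (x.2 / x.1) / x.1) := by
    unfold kernelOne
    fun_prop
  have hf' : AEStronglyMeasurable (fun x : ℝ × ℝ => f (LogSurface.ray θ x.2))
      (volume.restrict (Ioi (0 : ℝ) ×ˢ Ioi (0 : ℝ))) := by
    rw [Measure.volume_eq_prod, ← Measure.prod_restrict]
    exact hf.comp_snd
  refine (hker.aestronglyMeasurable.mul hf').congr ?_
  filter_upwards [ae_restrict_mem (measurableSet_Ioi.prod measurableSet_Ioi)] with x hx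
  exact (convIntegrand_zero_eq p q f z θ hx.1 hx.2).symm

lemma integrableOn_convIntegrand_zero (hq : 1 < q) (hpq : q < p) {c : ℝ}
    (hf_meas : AEStronglyMeasurable (fun r => f (LogSurface.ray θ r)) (volume.restrict (Ioi 0)))
    (hf : ∀ r : ℝ, 0 < r → ‖f (LogSurface.ray θ r)‖
      ≤ c * Real.exp (weightOmega (pqFactorial p q) (r / k)))
    (hz : z.modulus < k)
    (hζ : Complex.exp (θ * Complex.I) / z.toComplex ∈ Complex.slitPlane) :
    IntegrableOn (fun x : ℝ × ℝ => convIntegrand p q f z θ 0 x.1 x.2)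
      (Ioi (0 : ℝ) ×ˢ Ioi (0 : ℝ)) volume := by
  have hmeas := aestronglyMeasurable_convIntegrand_zero
    ((one_lt_div (zero_lt_one.trans hq)).mpr hpq) hf_meas z
  refine ⟨hmeas, ?_⟩
  rw [Measure.volume_eq_prod, ← Measure.prod_restrict] at hmeas ⊢
  rw [HasFiniteIntegral, lintegral_prod _ hmeas.enorm]
  exact lintegral_convIntegrand_zero_lt_top hq hpq hf hz hζ

end Convolution

theorem mainTheorem7_general (hq : 1 < q) (hpq : q < p) {d α : ℝ} (hα : 0 < α)
    {f : LogSurface → ℂ} (hcont : ContinuousOn f (LogSurface.sector d α))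
    (hgrowth : ∀ θ : ℝ, |θ - d| < α / 2 → ∃ c : ℝ, ∀ r : ℝ, 0 < r →
      ‖f (LogSurface.ray θ r)‖ ≤ c * Real.exp (weightOmega (pqFactorial p q) (r / k)))
    {z : LogSurface} (hz : z.modulus < k) :
    ∃ U ∈ 𝓝 z, ∃ θ φ : ℝ, (∀ r : ℝ, 0 < r → LogSurface.ray θ r ∈ LogSurface.sector d α) ∧
      ∀ z' ∈ U,
        IntegrableOn (fun x : ℝ × ℝ => convIntegrand p q f z' θ φ x.1 x.2)
          (Ioi (0 : ℝ) ×ˢ Ioi (0 : ℝ)) volume ∧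
        (∫⁻ s in Ioi (0 : ℝ), ∫⁻ r in Ioi (0 : ℝ), ‖convIntegrand p q f z' θ φ s r‖ₑ) < ⊤ := by
  obtain ⟨θ, hθ, hζ⟩ := LogSurface.exists_exp_div_toComplex_mem_slitPlane d hα z
  obtain ⟨c, hc⟩ := hgrowth θ hθ
  have hray : ∀ r : ℝ, 0 < r → LogSurface.ray θ r ∈ LogSurface.sector d α :=
    fun _ _ => LogSurface.ray_mem_sector_iff.mpr hθ
  have hmeas : AEStronglyMeasurable (fun r => f (LogSurface.ray θ r)) (volume.restrict (Ioi 0)) :=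
    (hcont.comp (LogSurface.continuousOn_ray θ) hray).aestronglyMeasurable measurableSet_Ioi
  have hmodulus : ∀ᶠ w in 𝓝 z, w.modulus < k :=
    LogSurface.continuous_modulus.continuousAt.eventually_lt_const hz
  have hslit : ∀ᶠ w in 𝓝 z, Complex.exp (θ * Complex.I) / w.toComplex ∈ Complex.slitPlane :=
    (continuousAt_const.div LogSurface.continuous_toComplex.continuousAt z.toComplex_ne_zero
      ).eventually_mem (Complex.isOpen_slitPlane.mem_nhds hζ)
  exact ⟨_, hmodulus.and hslit, θ, 0, hray, fun w hw =>
    ⟨integrableOn_convIntegrand_zero hq hpq hmeas hc hw.1 hw.2,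
      lintegral_convIntegrand_zero_lt_top hq hpq hc hw.1 hw.2⟩⟩

theorem mainTheorem7 (p q k : ℝ) (hq : 1 < q) (hpq : q < p) (hk : 1 < k)
    (d α : ℝ) (hα : 0 < α) (f : LogSurface → ℂ)
    (hf : MemGrowthClass (pqFactorial p q) k d α f)
    (z : LogSurface) (hz : z.modulus < min (p / q - 1) k) :
    ∃ U ∈ 𝓝 z, ∃ θ φ : ℝ, (∀ r : ℝ, 0 < r → LogSurface.ray θ r ∈ LogSurface.sector d α) ∧
      ∀ z' ∈ U,
        IntegrableOn (fun x : ℝ × ℝ => convIntegrand p q f z' θ φ x.1 x.2)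
          (Ioi (0 : ℝ) ×ˢ Ioi (0 : ℝ)) volume ∧
        (∫⁻ s in Ioi (0 : ℝ), ∫⁻ r in Ioi (0 : ℝ), ‖convIntegrand p q f z' θ φ s r‖ₑ) < ⊤ :=
  mainTheorem7_general hq hpq hα hf.holomorphic.continuousOn
    (fun _ hθ => hf.exists_norm_ray_le hθ) (hz.trans_le (min_le_right _ _))
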